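/- Let $H$ be a separable infinite-dimensional Hilbert space over $\mathbb{C}$ (or over $\mathbb{R}$), let $(e_j)_{j=1}^{\infty}$ be an orthonormal basis of $H$, and let $U$ be a unitary operator on $H$ whose diagonal $d_j = \langle U e_j, e_j\rangle$, $j \ge 1$, is a nonnegative nondecreasing sequence of real numbers. If $\sum_{j=1}^{\infty} (1-d_j) < \infty$, then \[ 1-d_1 \le \sum_{j=2}^{\infty} (1-d_j). \] -/

import Mathlib

/-! Put `T = U - 1`, so `‖T e_j‖² = 2(1 - d_j)`. Twice the right-hand sum is the squared
Hilbert–Schmidt norm of `T` off `e_0`, which is at least the part landing in the span of `e_0` and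
`w = U* e_0 - d_0 e_0`. Parseval for `T*` computes that part from `d_0` and `z = ⟪w, U e_0⟫`; the
bound `‖z‖ ≤ 1 - d_0²` then suffices. -/

/-- **Parseval's identity** for a Hilbert basis. -/
theorem HilbertBasis.hasSum_norm_inner_sq {ι 𝕜 H : Type*} [RCLike 𝕜] [NormedAddCommGroup H]
    [InnerProductSpace 𝕜 H] (e : HilbertBasis ι 𝕜 H) (y : H) :
    HasSum (fun i => ‖inner 𝕜 y (e i)‖ ^ 2) (‖y‖ ^ 2) := by
  have h := (RCLike.hasSum_re 𝕜 (e.hasSum_inner_mul_inner y y))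
  rw [inner_self_eq_norm_sq] at h
  convert h using 2 with i
  rw [← inner_conj_symm (e i) y, RCLike.mul_conj]
  norm_cast

/-- **Bessel's inequality** for a unit vector and a vector orthogonal to it,
without normalizing the latter. -/
theorem norm_inner_sq_add_norm_inner_sq_le {𝕜 H : Type*} [RCLike 𝕜] [NormedAddCommGroup H]
    [InnerProductSpace 𝕜 H] {x w : H} (hx : ‖x‖ = 1) (hxw : inner 𝕜 w x = 0) (v : H) :
    ‖w‖ ^ 2 * ‖inner 𝕜 x v‖ ^ 2 + ‖inner 𝕜 w v‖ ^ 2 ≤ ‖w‖ ^ 2 * ‖v‖ ^ 2 := by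
  set c := inner 𝕜 x v with hc
  have hw : inner 𝕜 w v = inner 𝕜 w (v - c • x) := by
    rw [inner_sub_right, inner_smul_right, hxw, mul_zero, sub_zero]
  have hv : ‖v - c • x‖ ^ 2 = ‖v‖ ^ 2 - ‖c‖ ^ 2 := by
    have hre : RCLike.re (inner 𝕜 v (c • x)) = ‖c‖ ^ 2 := by
      rw [inner_smul_right, ← inner_conj_symm, ← hc, RCLike.mul_conj]
      norm_cast
    rw [norm_sub_sq (𝕜 := 𝕜), hre, norm_smul, hx]
    ring
  have h := pow_le_pow_left₀ (norm_nonneg _) (norm_inner_le_norm (𝕜 := 𝕜) w (v - c • x)) 2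
  rw [mul_pow, hv, ← hw] at h
  linarith

/-- For `w` orthogonal to `e 0`, the sum of `‖T (e j)‖ ^ 2` over `j ≠ 0` bounds the contribution
of the components of `T (e j)` along `e 0` and `w`. -/
theorem HilbertBasis.norm_adjoint_sub_sq_le_tsum {𝕜 H : Type*} [RCLike 𝕜] [NormedAddCommGroup H]
    [InnerProductSpace 𝕜 H] [CompleteSpace H] (e : HilbertBasis ℕ 𝕜 H) (T : H →L[𝕜] H)
    {w : H} (hw : inner 𝕜 w (e 0) = 0) (hT : Summable fun j => ‖T (e (j + 1))‖ ^ 2) :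
    ‖w‖ ^ 2 * (‖T.adjoint (e 0)‖ ^ 2 - ‖inner 𝕜 (e 0) (T (e 0))‖ ^ 2) +
      (‖T.adjoint w‖ ^ 2 - ‖inner 𝕜 w (T (e 0))‖ ^ 2) ≤
        ‖w‖ ^ 2 * ∑' j, ‖T (e (j + 1))‖ ^ 2 := by
  have key (y : H) : HasSum (fun j => ‖inner 𝕜 y (T (e (j + 1)))‖ ^ 2)
      (‖T.adjoint y‖ ^ 2 - ‖inner 𝕜 y (T (e 0))‖ ^ 2) := by
    have h := e.hasSum_norm_inner_sq (T.adjoint y)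
    simp only [ContinuousLinearMap.adjoint_inner_left] at h
    -- Parseval for `T* y`, with the `j = 0` term moved across.
    simpa using (hasSum_nat_add_iff' 1).2 h
  exact hasSum_le (fun j => norm_inner_sq_add_norm_inner_sq_le (e.orthonormal.1 0) hw _)
    (((key (e 0)).mul_left _).add (key w)) (hT.hasSum.mul_left _)

theorem mainTheorem3 {𝕜 : Type*} [RCLike 𝕜] {H : Type*} [NormedAddCommGroup H]
    [InnerProductSpace 𝕜 H] [CompleteSpace H]
    (e : HilbertBasis ℕ 𝕜 H) (U : H →L[𝕜] H) (hU : U ∈ unitary (H →L[𝕜] H))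
    (d : ℕ → ℝ) (hdiag : ∀ j, inner 𝕜 (e j) (U (e j)) = (d j : 𝕜))
    (hnonneg : ∀ j, 0 ≤ d j) (hmono : Monotone d)
    (hsum : Summable fun j => 1 - d j) :
    1 - d 0 ≤ ∑' j, (1 - d (j + 1)) := by
  have hnU (v : H) : ‖U v‖ = ‖v‖ := ContinuousLinearMap.norm_map_of_mem_unitary hU v
  have hnA (v : H) : ‖U.adjoint v‖ = ‖v‖ :=
    ContinuousLinearMap.norm_map_of_mem_unitary (Unitary.star_mem hU) v
  have hUA (v : H) : U (U.adjoint v) = v := congr($(Unitary.mul_star_self_of_mem hU) v)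
  have hA (v : H) : (U - 1).adjoint v = U.adjoint v - v := by
    rw [← ContinuousLinearMap.star_eq_adjoint (U - 1), star_sub, star_one]; rfl
  have hn (j : ℕ) : ‖e j‖ = 1 := e.orthonormal.1 j
  have hT (j : ℕ) : ‖(U - 1) (e j)‖ ^ 2 = 2 * (1 - d j) := by
    have hre : RCLike.re (inner 𝕜 (U (e j)) (e j)) = d j := by
      rw [inner_re_symm, hdiag, RCLike.ofReal_re]
    change ‖U (e j) - e j‖ ^ 2 = _
    rw [norm_sub_sq (𝕜 := 𝕜), hre, hnU, hn]
    ring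
  have hd (j : ℕ) : d j ≤ 1 := by nlinarith [hT j, sq_nonneg ‖(U - 1) (e j)‖]
  -- If `d 0 = 1` then `w = 0`, and the final division by `‖w‖² = 1 - d 0 ^ 2` is unavailable.
  obtain h1 | h1 := (hd 0).eq_or_lt
  · rw [h1, sub_self]
    exact tsum_nonneg fun j => sub_nonneg.2 (hd _)
  have hs : Summable fun j => 1 - d (j + 1) := (summable_nat_add_iff 1).2 hsum
  set x := e 0 with hx
  have hxx : inner 𝕜 x x = 1 := by rw [inner_self_eq_norm_sq_to_K, hn]; simp
  set w := U.adjoint x - (d 0 : 𝕜) • x with hwdef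
  set z := inner 𝕜 w (U x) with hz
  have hAx : inner 𝕜 (U.adjoint x) x = (d 0 : 𝕜) := by
    rw [ContinuousLinearMap.adjoint_inner_left, hdiag]
  have hwx : inner 𝕜 w x = 0 := by
    rw [hwdef, inner_sub_left, inner_smul_left, hAx, hxx]; simp
  have hdev (v : H) (hv : ‖v‖ = 1) (hvx : inner 𝕜 v x = (d 0 : 𝕜)) :
      ‖v - (d 0 : 𝕜) • x‖ ^ 2 = 1 - d 0 ^ 2 := by
    rw [norm_sub_sq (𝕜 := 𝕜), inner_smul_right, hvx, norm_smul, hn, hv, RCLike.norm_ofReal,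
      ← RCLike.ofReal_mul, RCLike.ofReal_re, mul_one, sq_abs]
    ring
  have hw : ‖w‖ ^ 2 = 1 - d 0 ^ 2 := hdev _ (by rw [hnA, hn]) hAx
  have hzle : ‖z‖ ≤ 1 - d 0 ^ 2 := by
    have hUx : ‖U x - (d 0 : 𝕜) • x‖ ^ 2 = 1 - d 0 ^ 2 :=
      hdev _ (by rw [hnU, hn]) (by rw [← inner_conj_symm, hdiag, RCLike.conj_ofReal])
    have hz' : z = inner 𝕜 w (U x - (d 0 : 𝕜) • x) := by
      rw [inner_sub_right, inner_smul_right, hwx, mul_zero, sub_zero]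
    rw [hz']
    refine (norm_inner_le_norm _ _).trans ?_
    nlinarith [sq_nonneg (‖w‖ - ‖U x - (d 0 : 𝕜) • x‖)]
  have hAw : ‖(U - 1).adjoint w‖ ^ 2 = 2 * (1 - d 0 ^ 2) + 2 * (d 0 * RCLike.re z) := by
    have hUw : inner 𝕜 (U.adjoint w) w = -(d 0 * z) := by
      rw [ContinuousLinearMap.adjoint_inner_left]
      nth_rewrite 2 [hwdef]
      rw [map_sub, map_smul, hUA, inner_sub_right, inner_smul_right, hwx, zero_sub]
    rw [hA, norm_sub_sq (𝕜 := 𝕜), hUw, hnA, hw, map_neg, RCLike.re_ofReal_mul]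
    ring
  have hAx' : ‖(U - 1).adjoint x‖ ^ 2 = 2 * (1 - d 0) := by
    rw [hA, norm_sub_sq (𝕜 := 𝕜), hAx, hnA, hn, RCLike.ofReal_re]
    ring
  have hx0 : ‖inner 𝕜 x ((U - 1) x)‖ ^ 2 = (1 - d 0) ^ 2 := by
    have h : inner 𝕜 x ((U - 1) x) = ((d 0 - 1 : ℝ) : 𝕜) := by
      change inner 𝕜 x (U x - x) = _
      rw [inner_sub_right, hdiag, hxx]; simp
    rw [h, RCLike.norm_ofReal, sq_abs]
    ring
  have hw0 : inner 𝕜 w ((U - 1) x) = z := by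
    change inner 𝕜 w (U x - x) = _
    rw [inner_sub_right, hwx, sub_zero]
  have main := e.norm_adjoint_sub_sq_le_tsum (U - 1) hwx
    (by simpa only [hT] using hs.mul_left 2)
  simp only [hT, tsum_mul_left] at main
  rw [← hx, hAx', hx0, hw0, hAw, hw] at main
  have hre : -‖z‖ ≤ RCLike.re z := (abs_le.1 (RCLike.abs_re_le_norm z)).1
  have hS : 0 < 1 - d 0 ^ 2 := by nlinarith [hnonneg 0]
  have h2 : 0 ≤ d 0 * (RCLike.re z + ‖z‖) := mul_nonneg (hnonneg 0) (by linarith)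
  have h3 : 0 ≤ d 0 * (1 - d 0 ^ 2 - ‖z‖) := mul_nonneg (hnonneg 0) (by linarith)
  have h4 : ‖z‖ ^ 2 ≤ (1 - d 0 ^ 2) ^ 2 := pow_le_pow_left₀ (norm_nonneg _) hzle 2
  -- With `S = 1 - d 0 ^ 2`, `main` reads `S² + 2S + 2 d_0 Re z - ‖z‖² ≤ 2S ∑`. Its left side is
  -- smallest at `z = -S`, where it equals `2S(1 - d_0)`.
  refine le_of_mul_le_mul_left ?_ hS
  nlinarith
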